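/- All cardinals in the regularity notation are infinite. For cardinals $\mu,\lambda$ let $S_\mu(\lambda)$ be the set of subsets of $\lambda$ of cardinality $<\mu$, ordered by inclusion, and let $\operatorname{cf} S_\mu(\lambda)$ be the least cardinality of a cofinal subset of it. An ultrafilter $D$ over a set $I$ is $(\mu,\lambda)$-regular if there is $f:I\to S_\mu(\lambda)$ with $\{i\in I : \alpha\in f(i)\}\in D$ for every $\alpha\in\lambda$; it is $\lambda$-decomposable if there is $f:I\to\lambda$ such that $f^{-1}(X)\notin D$ for every $X\subseteq\lambda$ with $|X|<\lambda$. Write $\lambda^{<\lambda}=\sup_{\nu<\lambda}\lambda^{\nu}$. For a set $\mathbf a$ of cardinals, $\kappa\in\operatorname{pcf}\mathbf a$ means that all elements of $\mathbf a$ are (infinite) regular cardinals and that $\kappa=\operatorname{cf}\prod_{D'}\mathbf a$ for some ultrafilter $D'$ over $\mathbf a$. **Theorem 6.5.** Let $\lambda$ be a singular cardinal, $\kappa>\lambda$ a cardinal with $\operatorname{cf}\lambda\neq\operatorname{cf}\kappa$, and let $D$ be a $(\lambda^+,\kappa)$-regular ultrafilter over a set. Assume that one of the following holds: (a) $\lambda$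 is a strong limit cardinal and $\operatorname{cf} S_\lambda(\lambda)<2^\kappa$; (b) $\lambda^{<\lambda}<\kappa$; (c) $\kappa$ is regular, and there is no set $\mathbf a$ of cardinals below $\lambda$ with $|\mathbf a|<\lambda$, $\sup\mathbf a=\lambda$ and $\kappa\in\operatorname{pcf}\mathbf a$. Then $D$ is either $\lambda$-decomposable, or $(\lambda',\kappa)$-regular for some infinite cardinal $\lambda'<\lambda$. Moreover, $\lambda^{<\lambda}<2^\kappa$ implies $\operatorname{cf} S_\lambda(\lambda)<2^\kappa$ (so in (a) it suffices that $\lambda$ is a strong limit cardinal with $\lambda^{<\lambda}<2^\kappa$). -/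

import Mathlib

universe u v

open Cardinal

namespace RegularUltrafilters

/-- `S_mu(lam)`: the set of all subsets of (the initial ordinal of) `lam` of cardinality `< mu`,
partially ordered by inclusion. -/
abbrev SmallSubsets (mu lam : Cardinal.{u}) : Type u :=
  {s : Set lam.ord.ToType // #s < mu}

/-- An ultrafilter `D` over `I` is `(mu, lam)`-regular if there is `f : I → S_mu(lam)` such that
`{i | α ∈ f i} ∈ D` for every `α ∈ lam`. This is meant for infinite cardinals `mu` and `lam`. -/
def IsRegularUltrafilter {I : Type v} (D : Ultrafilter I) (mu lam : Cardinal.{u}) : Prop :=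
  ∃ f : I → SmallSubsets mu lam, ∀ α : lam.ord.ToType, {i | α ∈ (f i).1} ∈ D

/-- An ultrafilter `D` over `I` is `lam`-decomposable if there is `f : I → lam` such that
`f⁻¹(X) ∉ D` whenever `X ⊆ lam` has cardinality `< lam`. (The fibres of such an `f` form a
partition of `I` into `lam` classes such that no union of fewer than `lam` of them is in `D`.) -/
def IsDecomposable {I : Type v} (D : Ultrafilter I) (lam : Cardinal.{u}) : Prop :=
  ∃ f : I → lam.ord.ToType, ∀ X : Set lam.ord.ToType, #X < lam → f ⁻¹' X ∉ D

/-- The ultraproduct order: `[f] ≤ [g]` iff `f i ≤ g i` for `D`-almost all `i`. -/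
instance ultraproductPreorder {ι : Type v} (D : Ultrafilter ι) (A : ι → Type u)
    [∀ i, Preorder (A i)] : Preorder ((D : Filter ι).Product A) where
  le := Quotient.lift₂ (fun f g => ∀ᶠ i in (D : Filter ι), f i ≤ g i) (by
    intro f₁ g₁ f₂ g₂ hf hg
    have hf' : ∀ᶠ i in (D : Filter ι), f₁ i = f₂ i := hf
    have hg' : ∀ᶠ i in (D : Filter ι), g₁ i = g₂ i := hg
    exact propext (Filter.eventually_congr
      ((hf'.and hg').mono fun i h => by rw [h.1, h.2])))
  le_refl x := Quotient.inductionOn x fun _ => Filter.Eventually.of_forall fun _ => le_rfl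
  le_trans x y z := Quotient.inductionOn₃ x y z fun _ _ _ h₁ h₂ =>
    (Filter.Eventually.and h₁ h₂).mono fun _ h => h.1.trans h.2

/-- `pcf a`, the set of possible cofinalities of a set `a` of regular cardinals: `kap ∈ pcf a` iff
`a` is a set of (infinite) regular cardinals and `kap` is the cofinality of the ultraproduct
`∏_{D'} a` of the well-orders `c ∈ a`, for some ultrafilter `D'` over `a`. -/
def pcf (a : Set Cardinal.{u}) : Set Cardinal.{u} :=
  {kap | (∀ c ∈ a, c.IsRegular) ∧ ∃ D' : Ultrafilter a,
    Cardinal.lift.{u + 1} kap =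
      Order.cof ((D' : Filter a).Product fun c : a => (c : Cardinal.{u}).ord.ToType)}

end RegularUltrafilters

/-!
The notation is that of the statement; suppose `D` is not `lam`-decomposable. This is used in the
following form: every function from `I` to a set of size at most `lam` takes, modulo `D`, fewer than
`lam` values. By `(lam⁺, kap)`-regularity there are sets `f i ⊆ kap` of size at most `lam`,
containing each point of `kap` for almost all `i`, with injections `e i : f i → lam`. Each `α < kap`
thus gives a function `i ↦ e i α` into `lam`; to improve the regularity one has to confine the
values of `kap` many of these functions to a common small set.

*Few small subsets (b).* For each `α` the values of `i ↦ e i α` lie, modulo `D`, in a set `X α` of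
size `< lam`. As `cf lam ≠ cf kap`, the sizes of `kap` many of the `X α` have a common bound
(`exists_le_mk_setOf_le`), and if there are fewer than `kap` candidates for `X α`, then for each
regular `nu ≤ kap` above the number of candidates, `nu` many `α` share the same set. If `kap` is
singular, then `cf kap < kap`, and the resulting regularity up to each such `nu < kap`, in
particular up to `cf kap`, suffices to glue (`isRegularUltrafilter_of_coloring`).

*Strong limits (a).* If no function into `lam` lies above all constants, each `i ↦ e i α` is bounded
modulo `D`, and `cf lam ≠ cf kap` gives a common bound for `kap` many `α`
(`exists_isRegularUltrafilter_of_forall_bounded`). Otherwise, indecomposability improves to a uniform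
`rho < lam` such that all functions into `lam` take at most `rho` values modulo `D`
(`exists_forall_exists_mk_le`), so that there are fewer than `lam` functions into a given set of
size `< lam` modulo `D` (`mk_quotient_eventuallyEqSetoid_lt`). Subsets of `kap` are coded by fewer
than `lam` functions into `lam` each, and counting codes yields `2 ^ kap ≤ cf S_lam(lam) * lam`
(`isDecomposable_of_isStrongLimit`).

*Possible cofinalities (c).* An `(ℵ₀, lam)`-regular ultrafilter is `lam`-decomposable, so `D` is not
`(ℵ₀, lam)`-regular. Kanamori's theorem (`exists_least_isAboveConstants`) then provides a least
function `g : I → kap` above all constants, unless `D` is `(ℵ₀, kap)`-regular. The constants are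
cofinal below `g` in the ultrapower, hence `∏_D cf (g i)` has cofinality `kap`. The cofinalities
`cf (g i)` are below `lam` because of the sets `f i`, and unbounded in `lam` if `D` is not
`(mu, kap)`-regular for any `mu < lam`. By indecomposability they take fewer than `lam` values, and
functions in `∏_D cf (g i)` are dominated by functions of the value `cf (g i)`. So the set of values
has `kap` among its possible cofinalities (`mem_pcf_of_least`).
-/

namespace RegularUltrafilters

open Set Filter Order

/-! ### Cofinality and pigeonhole principles -/

theorem cof_eq_of_monotone {α β : Type u} [LinearOrder α] [LinearOrder β] [NoMaxOrder β]
    {f : α → β} (hf : Monotone f) (hf' : IsCofinal (range f)) : cof α = cof β := by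
  apply le_antisymm
  · obtain ⟨s, hs, hs'⟩ := exists_cof_eq (α := β)
    have hex : ∀ b : β, ∃ a, b ≤ f a := fun b => by
      obtain ⟨_, ⟨a, rfl⟩, h⟩ := hf' b
      exact ⟨a, h⟩
    choose g hg using hex
    rw [← hs']
    refine (cof_le (s := g '' s) fun a => ?_).trans mk_image_le
    obtain ⟨c, hc⟩ := exists_gt (f a)
    obtain ⟨b, hb, hcb⟩ := hs c
    refine ⟨g b, mem_image_of_mem g hb, le_of_lt ?_⟩
    by_contra h
    exact absurd (hf (not_lt.1 h)) (not_le.2 (hc.trans_le (hcb.trans (hg b))))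
  · obtain ⟨s, hs, hs'⟩ := exists_cof_eq (α := α)
    rw [← hs']
    exact (cof_le (hs.image hf hf')).trans mk_image_le

theorem exists_forall_lt_of_mk_lt_cof {c : Cardinal.{u}} {s : Set c.ord.ToType}
    (hs : #s < c.ord.cof) : ∃ b, ∀ x ∈ s, x < b := by
  rw [← not_isCofinal_iff]
  intro h
  exact absurd (cof_le h) (by rwa [Ordinal.cof_toType, not_le])

theorem exists_forall_lt_of_isRegular {c : Cardinal.{u}} (hc : c.IsRegular) {ι : Type u}
    (hι : #ι < c) (f : ι → c.ord.ToType) : ∃ b, ∀ x, f x < b := by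
  obtain ⟨b, hb⟩ := exists_forall_lt_of_mk_lt_cof (c := c) (s := range f)
    (by rw [hc.cof_ord]; exact mk_range_le.trans_lt hι)
  exact ⟨b, fun x => hb _ (mem_range_self x)⟩

theorem mk_Iio_toType_lt {c : Cardinal.{u}} (t : c.ord.ToType) : #(Iio t) < c := by
  simpa using mk_Iio_lt t

theorem mk_Iio_toType_mk {o : Ordinal.{u}} (x : Iio o) :
    #(Iio (Ordinal.ToType.mk x)) = x.1.card := by
  have h : Ordinal.typein (α := o.ToType) (· < ·) (Ordinal.ToType.mk x) = x.1 :=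
    congrArg Subtype.val (Ordinal.ToType.mk.symm_apply_apply x)
  rw [← h]
  rfl

theorem exists_mk_Iio_eq {c r : Cardinal.{u}} (h : r < c) :
    ∃ t : c.ord.ToType, #(Iio t) = r :=
  ⟨Ordinal.ToType.mk ⟨r.ord, ord_lt_ord.2 h⟩, by simp [mk_Iio_toType_mk]⟩

/-- If `kap` many points are distributed over an increasing union of length `lam`, where
`lam < kap` and the cofinalities differ, then some stage of the union has `kap` many points:
otherwise the sizes of the stages would be a monotone cofinal map from `lam` to `kap`. -/
theorem exists_le_mk_setOf_le {lam kap : Cardinal.{u}} (hlam : ℵ₀ ≤ lam) (hlt : lam < kap)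
    (hcof : lam.ord.cof ≠ kap.ord.cof) {A : Type u} (hA : kap ≤ #A) (c : A → lam.ord.ToType) :
    ∃ t, kap ≤ #{a | c a ≤ t} := by
  by_contra! h
  have := noMaxOrder (hlam.trans hlt.le)
  refine hcof ?_
  rw [← Ordinal.cof_toType, ← Ordinal.cof_toType kap.ord]
  refine cof_eq_of_monotone
    (f := fun t => Ordinal.ToType.mk ⟨(#{a | c a ≤ t}).ord, ord_lt_ord.2 (h t)⟩) ?_ ?_
  · intro s t hst
    refine Ordinal.ToType.mk.monotone ?_
    exact Subtype.mk_le_mk.2 (ord_le_ord.2 (mk_le_mk_of_subset fun a ha => le_trans ha hst))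
  · intro o
    by_contra! ho
    have key : ∀ t, #{a | c a ≤ t} ≤ #(Iio o) := by
      intro t
      have := (mk_le_mk_of_subset (Iio_subset_Iio (ho _ (mem_range_self t)).le))
      rwa [mk_Iio_toType_mk, card_ord] at this
    have h1 : #A ≤ lam * #(Iio o) := by
      have : (univ : Set A) = ⋃ t, {a | c a ≤ t} := by
        ext a
        simp only [mem_univ, mem_iUnion, mem_ofPred_eq, true_iff]
        exact ⟨c a, le_rfl⟩
      rw [← mk_univ, this]
      refine (mk_iUnion_le_sum_mk).trans ((sum_le_sum _ _ key).trans ?_)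
      simp
    exact absurd (hA.trans h1)
      (not_le.2 (mul_lt_of_lt (hlam.trans hlt.le) hlt (mk_Iio_toType_lt o)))

/-- Well-founded recursion for sequences subject to a condition `Q` on each term and a condition
`R` on each pair of terms. -/
theorem exists_seq_of_forall_exists {T X : Type*} [LinearOrder T] [WellFoundedLT T] [Nonempty X]
    {Q : X → Prop} {R : X → X → Prop}
    (h : ∀ (t : T) (d : T → X), (∀ s < t, Q (d s)) → (∀ s < t, ∀ r < s, R (d r) (d s)) →
      ∃ x, Q x ∧ ∀ s < t, R (d s) x) :
    ∃ d : T → X, (∀ t, Q (d t)) ∧ ∀ t, ∀ s < t, R (d s) (d t) := by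
  classical
  let F : (t : T) → ((s : T) → s < t → X) → X := fun t prev =>
    if hx : ∃ x, Q x ∧ ∀ s, ∀ hs : s < t, R (prev s hs) x then hx.choose
    else Classical.arbitrary X
  let d : T → X := wellFounded_lt.fix F
  have hd : ∀ t, d t = F t fun s _ => d s := fun t => wellFounded_lt.fix_eq F t
  have key : ∀ t, Q (d t) ∧ ∀ s < t, R (d s) (d t) := by
    intro t
    induction t using WellFoundedLT.induction with
    | ind t ih =>
      have hx : ∃ x, Q x ∧ ∀ s < t, R (d s) x :=
        h t d (fun s hs => (ih s hs).1) fun s hs => (ih s hs).2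
      rw [hd t]
      simp only [F, dif_pos hx]
      exact hx.choose_spec
  exact ⟨d, fun t => (key t).1, fun t => (key t).2⟩

/-! ### Regularity and indecomposability over arbitrary index types -/

/-- `(mu, #A)`-regularity of `D`, witnessed on an arbitrary type `A` instead of an initial
ordinal. -/
def IsRegularOn {I : Type v} (D : Ultrafilter I) (mu : Cardinal.{u}) (A : Type u) : Prop :=
  ∃ f : I → Set A, (∀ i, #(f i) < mu) ∧ ∀ a, ∀ᶠ i in (D : Filter I), a ∈ f i

variable {I : Type v} {D : Ultrafilter I}

theorem IsRegularOn.isRegularUltrafilter {mu kap : Cardinal.{u}} {A : Type u}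
    (h : IsRegularOn D mu A) (hA : kap ≤ #A) : IsRegularUltrafilter D mu kap := by
  obtain ⟨f, hf, hf'⟩ := h
  rw [← mk_ord_toType kap] at hA
  obtain ⟨e⟩ := hA
  exact ⟨fun i => ⟨e ⁻¹' f i, (mk_preimage_of_injective _ _ e.injective).trans_lt (hf i)⟩,
    fun α => hf' (e α)⟩

theorem IsRegularOn.mono {mu : Cardinal.{u}} {A B : Type u}
    (h : IsRegularOn D mu A) (hA : #B ≤ #A) : IsRegularOn D mu B := by
  obtain ⟨f, hf, hf'⟩ := h
  obtain ⟨e⟩ := hA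
  exact ⟨fun i => e ⁻¹' f i, fun i => (mk_preimage_of_injective _ _ e.injective).trans_lt (hf i),
    fun α => hf' (e α)⟩

theorem exists_eventually_mem_of_not_isDecomposable {lam : Cardinal.{u}}
    (hD : ¬ IsDecomposable D lam) {A : Type u} (hA : #A ≤ lam) (g : I → A) :
    ∃ X : Set A, #X < lam ∧ ∀ᶠ i in (D : Filter I), g i ∈ X := by
  rw [← mk_ord_toType lam] at hA
  obtain ⟨e⟩ := hA
  simp only [IsDecomposable, not_exists, not_forall, not_not] at hD
  obtain ⟨X, hX, hX'⟩ := hD (e ∘ g)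
  exact ⟨e ⁻¹' X, (mk_preimage_of_injective _ _ e.injective).trans_lt hX, hX'⟩

/-- A `(lam⁺, kap)`-regular ultrafilter comes with sets `f i` of size at most `lam`, each of them
enumerated injectively by `lam`. -/
theorem exists_injOn_of_isRegularUltrafilter {lam kap : Cardinal.{u}} (hlam : lam ≠ 0)
    (hreg : IsRegularUltrafilter D (succ lam) kap) :
    ∃ (f : I → Set kap.ord.ToType) (e : I → kap.ord.ToType → lam.ord.ToType),
      (∀ i, #(f i) ≤ lam) ∧ (∀ i, InjOn (e i) (f i)) ∧
        ∀ a, ∀ᶠ i in (D : Filter I), a ∈ f i := by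
  classical
  obtain ⟨f, hf⟩ := hreg
  have hle : ∀ i, #(f i).1 ≤ lam := fun i => lt_succ_iff.1 (f i).2
  have := nonempty_ord_toType hlam
  have he : ∀ i, Nonempty ((f i).1 ↪ lam.ord.ToType) := fun i =>
    (Cardinal.le_def _ _).1 ((hle i).trans (mk_ord_toType lam).ge)
  let e : ∀ i, (f i).1 ↪ lam.ord.ToType := fun i => (he i).some
  refine ⟨fun i => (f i).1, fun i a => if h : a ∈ (f i).1 then e i ⟨a, h⟩ else
    Classical.arbitrary _, hle, ?_, hf⟩
  intro i a ha b hb hab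
  simp only [dif_pos ha, dif_pos hb] at hab
  simpa using (e i).injective hab

theorem mk_sep_le_of_injOn {A T : Type u} {s : Set A} {e : A → T} (he : InjOn e s) (X : Set T) :
    #{a | a ∈ s ∧ e a ∈ X} ≤ #X :=
  (mk_image_eq_of_injOn e {a | a ∈ s ∧ e a ∈ X} fun a ha b hb => he ha.1 hb.1).symm.trans_le <|
    mk_le_mk_of_subset (by rintro _ ⟨a, ha, rfl⟩; exact ha.2)

/-- If no function into `lam` is above all constants, then `D` is already `(mu, kap)`-regular for
some `mu < lam`: each point of `kap` is enumerated below a fixed bound, and `kap` many points share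
the bound. -/
theorem exists_isRegularUltrafilter_of_forall_bounded {lam kap : Cardinal.{u}}
    (hlam : lam.IsSingular) (hlt : lam < kap) (hcof : lam.ord.cof ≠ kap.ord.cof)
    (hreg : IsRegularUltrafilter D (succ lam) kap)
    (hH : ¬ ∃ H : I → lam.ord.ToType, ∀ t, ∀ᶠ i in (D : Filter I), t < H i) :
    ∃ mu : Cardinal.{u}, ℵ₀ ≤ mu ∧ mu < lam ∧ IsRegularUltrafilter D mu kap := by
  obtain ⟨f, e, -, he, hf⟩ := exists_injOn_of_isRegularUltrafilter hlam.pos.ne' hreg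
  have hb : ∀ a, ∃ t, ∀ᶠ i in (D : Filter I), e i a ≤ t := by
    intro a
    by_contra! h
    refine hH ⟨fun i => e i a, fun t => ?_⟩
    simpa [Ultrafilter.frequently_iff_eventually] using h t
  choose t ht using hb
  obtain ⟨s, hs⟩ := exists_le_mk_setOf_le hlam.aleph0_le hlt hcof (mk_ord_toType kap).ge t
  have hlim := hlam.isSuccLimit
  have := noMaxOrder hlam.aleph0_le
  obtain ⟨s', hs'⟩ := exists_gt s
  refine ⟨succ (max #(Iio s') ℵ₀), (le_max_right _ _).trans (le_succ _),
    hlim.succ_lt (max_lt (mk_Iio_toType_lt s')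
      (hlam.aleph0_le.lt_of_ne fun h => not_isSingular_aleph0 (h ▸ hlam))), ?_⟩
  refine IsRegularOn.isRegularUltrafilter (A := {a | t a ≤ s}) ⟨fun i => {a | a.1 ∈ f i ∧ e i a ≤ s},
    fun i => lt_succ_iff.2 (le_max_of_le_left ?_), fun a => ?_⟩ hs
  · refine le_trans ?_ (mk_sep_le_of_injOn (he i) (Iio s'))
    refine mk_le_of_injective (f := fun x => ⟨x.1.1, x.2.1, x.2.2.trans_lt hs'⟩) ?_
    intro x y hxy
    exact Subtype.ext (Subtype.ext (by simpa using hxy))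
  · filter_upwards [hf a, ht a] with i h1 h2 using ⟨h1, h2.trans a.2⟩

/-! ### The case of few small subsets -/

theorem mk_smallSubsets_le {lam : Cardinal.{u}} (hlam : ℵ₀ ≤ lam) :
    #(SmallSubsets lam lam) ≤ lam * lam ^< lam := by
  have h : {s : Set lam.ord.ToType | #s < lam} ⊆ ⋃ t : lam.ord.ToType, {s | #s ≤ #(Iio t)} := by
    intro s hs
    obtain ⟨t, ht⟩ := exists_mk_Iio_eq hs
    exact mem_iUnion.2 ⟨t, ht.ge⟩
  refine (mk_le_mk_of_subset h).trans (mk_iUnion_le_sum_mk.trans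
    ((sum_le_sum _ (fun _ => lam ^< lam) fun t => ?_).trans (by simp)))
  refine (mk_bounded_set_le lam.ord.ToType #(Iio t)).trans ?_
  rw [mk_ord_toType, max_eq_left hlam]
  exact le_powerlt lam (mk_Iio_toType_lt t)

theorem le_powerlt_self {lam : Cardinal.{u}} (hlam : ℵ₀ ≤ lam) : lam ≤ lam ^< lam := by
  simpa using le_powerlt lam (one_lt_aleph0.trans_le hlam)

theorem mk_smallSubsets_le_powerlt {lam : Cardinal.{u}} (hlam : ℵ₀ ≤ lam) :
    #(SmallSubsets lam lam) ≤ lam ^< lam :=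
  (mk_smallSubsets_le hlam).trans
    (mul_le_of_le (hlam.trans (le_powerlt_self hlam)) (le_powerlt_self hlam) le_rfl)

/-- Let `A` have at least `kap` elements, coloured by `X` with fewer than `kap` colours, and let each
colour `s` come with sets `f s i` of size at most `rho` which contain, modulo `D`, every point of
colour `s`. Then `D` is `(rho⁺, kap)`-regular. For a regular `nu ≤ kap` above the number of colours,
some colour occurs `nu` times; if `kap` is singular, this applies to cofinally many `nu < kap`, and
to some `nu` above `cf kap`, which allows the witnesses for the various `nu` to be combined. -/
theorem isRegularUltrafilter_of_coloring {kap rho : Cardinal.{u}} (hrho : ℵ₀ ≤ rho)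
    (hkap : ℵ₀ ≤ kap) {A S : Type u} (hA : kap ≤ #A) (hS : #S < kap) (X : A → S)
    (f : S → I → Set A) (hf : ∀ s i, #(f s i) ≤ rho)
    (hfX : ∀ a, ∀ᶠ i in (D : Filter I), a ∈ f (X a) i) :
    IsRegularUltrafilter D (succ rho) kap := by
  have key : ∀ nu : Cardinal.{u}, nu.IsRegular → #S < nu → nu ≤ kap →
      ∀ B : Type u, #B = nu → IsRegularOn D (succ rho) B := by
    intro nu hnu hSnu hnuk B hB
    obtain ⟨s, hs⟩ := infinite_pigeonhole_card X nu (hnuk.trans hA) hnu.1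
      (by rwa [hnu.cof_ord])
    refine IsRegularOn.mono (A := X ⁻¹' {s}) ?_ (hB.le.trans hs)
    refine ⟨fun i => Subtype.val ⁻¹' f s i, fun i => lt_succ_iff.2 ?_, ?_⟩
    · exact (mk_preimage_of_injective _ _ Subtype.val_injective).trans (hf s i)
    · rintro ⟨a, rfl⟩
      exact hfX a
  rcases isRegular_or_isSingular hkap with hreg | hsing
  · exact (key kap hreg hS le_rfl kap.ord.ToType (mk_ord_toType kap)).isRegularUltrafilter
      (mk_ord_toType kap).ge
  -- `J` is cofinal in `kap`; the blocks `B j` have regular sizes with supremum `kap`.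
  obtain ⟨J, hJ, hJ'⟩ := exists_cof_eq (α := kap.ord.ToType)
  rw [Ordinal.cof_toType] at hJ'
  have hlim := hsing.isSuccLimit
  have hℵ : ℵ₀ < kap := hkap.lt_of_ne fun h => not_isSingular_aleph0 (h ▸ hsing)
  let nu : Cardinal.{u} → Cardinal.{u} := fun c => succ (max c (max #S ℵ₀))
  have hnu : ∀ c, (nu c).IsRegular := fun c => isRegular_succ (by simp)
  have hSnu : ∀ c, #S < nu c := fun c => lt_succ_iff.2 (by simp)
  have hnuk : ∀ c < kap, nu c < kap := fun c hc => hlim.succ_lt (max_lt hc (max_lt hS hℵ))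
  have hc : ∀ c, c < nu c := fun c => lt_succ_iff.2 (by simp)
  have hJr : IsRegularOn D (succ rho) J := by
    have hJk : #J < kap := by rw [hJ']; exact hsing.cof_ord_lt
    refine (key (nu #J) (hnu _) (hSnu _) (hnuk _ hJk).le _ (mk_ord_toType _)).mono ?_
    rw [mk_ord_toType]
    exact (hc _).le
  let B : J → Type u := fun j => (nu #(Iio j.1)).ord.ToType
  have hB : ∀ j, IsRegularOn D (succ rho) (B j) := fun j =>
    key (nu #(Iio j.1)) (hnu _) (hSnu _) (hnuk _ (mk_Iio_toType_lt _)).le _ (mk_ord_toType _)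
  obtain ⟨r, hr, hr'⟩ := hJr
  choose g hg hg' using hB
  refine IsRegularOn.isRegularUltrafilter (A := Σ j, B j)
    ⟨fun i => ⋃ j : r i, Sigma.mk j.1 '' g j.1 i, fun i => lt_succ_iff.2 ?_, ?_⟩ ?_
  · refine mk_iUnion_le_sum_mk.trans ((sum_le_sum _ (fun _ => rho) fun j =>
      mk_image_le.trans (lt_succ_iff.1 (hg _ _))).trans ?_)
    rw [sum_const']
    exact mul_le_of_le hrho (lt_succ_iff.1 (hr i)) le_rfl
  · rintro ⟨j, b⟩
    filter_upwards [hr' j, hg' j b] with i h1 h2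
    exact mem_iUnion.2 ⟨⟨j, h1⟩, mem_image_of_mem _ h2⟩
  · refine le_of_forall_lt fun c hck => ?_
    obtain ⟨t, ht⟩ := exists_mk_Iio_eq hck
    obtain ⟨j, hj, htj⟩ := hJ t
    have h1 : c < #(B ⟨j, hj⟩) := by
      rw [mk_ord_toType]
      refine lt_of_le_of_lt ?_ (hc _)
      rw [← ht]
      exact mk_le_mk_of_subset (Iio_subset_Iio htj)
    exact h1.trans_le (mk_le_of_injective (f := Sigma.mk (β := B) ⟨j, hj⟩) sigma_mk_injective)

theorem exists_isRegularUltrafilter_of_mk_smallSubsets_lt {lam kap : Cardinal.{u}}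
    (hlam : lam.IsSingular) (hlt : lam < kap) (hcof : lam.ord.cof ≠ kap.ord.cof)
    (hreg : IsRegularUltrafilter D (succ lam) kap) (hD : ¬ IsDecomposable D lam)
    (hS : #(SmallSubsets lam lam) < kap) :
    ∃ mu : Cardinal.{u}, ℵ₀ ≤ mu ∧ mu < lam ∧ IsRegularUltrafilter D mu kap := by
  obtain ⟨f, e, -, he, hf⟩ := exists_injOn_of_isRegularUltrafilter hlam.pos.ne' hreg
  choose X hX hX' using fun a => exists_eventually_mem_of_not_isDecomposable hD
    (mk_ord_toType lam).le fun i => e i a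
  choose c hc using fun a => exists_mk_Iio_eq (hX a)
  obtain ⟨s, hs⟩ := exists_le_mk_setOf_le hlam.aleph0_le hlt hcof (mk_ord_toType kap).ge c
  have hlim := hlam.isSuccLimit
  refine ⟨succ (max #(Iio s) ℵ₀), (le_max_right _ _).trans (le_succ _),
    hlim.succ_lt (max_lt (mk_Iio_toType_lt s)
      (hlam.aleph0_le.lt_of_ne fun h => not_isSingular_aleph0 (h ▸ hlam))), ?_⟩
  let S := {Y : SmallSubsets lam lam // #Y.1 ≤ #(Iio s)}
  refine isRegularUltrafilter_of_coloring (le_max_right _ _) (hlam.aleph0_le.trans hlt.le)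
    (A := {a | c a ≤ s}) (S := S) hs ((mk_subtype_le _).trans_lt hS)
    (fun a => ⟨⟨X a, hX a⟩, (hc a).symm.trans_le (mk_le_mk_of_subset (Iio_subset_Iio a.2))⟩)
    (fun Y i => Subtype.val ⁻¹' {a | a ∈ f i ∧ e i a ∈ Y.1.1}) ?_ ?_
  · intro Y i
    exact (mk_preimage_of_injective _ _ Subtype.val_injective).trans
      ((mk_sep_le_of_injOn (he i) _).trans (Y.2.trans (le_max_left _ _)))
  · intro a
    filter_upwards [hf a, hX' a] with i h1 h2 using ⟨h1, h2⟩

/-! ### Least functions -/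

/-- The functions `I → kap` which are, modulo `D`, above every constant. -/
def IsAboveConstants (D : Ultrafilter I) {kap : Cardinal.{u}} (g : I → kap.ord.ToType) : Prop :=
  ∀ α, ∀ᶠ i in (D : Filter I), α < g i

/-- For `kap` regular, a family of sets of size `< mu` which meets, modulo `D`, each of cofinally
many bounded intervals `[α, β)` yields `(mu, kap)`-regularity, as `kap` many of the intervals can be
chosen disjoint. Hence, without regularity, there is an `α` such that modulo `D` the family has no
bounded points above `α`. -/
theorem exists_forall_eventually_le_of_not_isRegularUltrafilter {mu kap : Cardinal.{u}}
    (hkap : kap.IsRegular) (hD : ¬ IsRegularUltrafilter D mu kap) (F : I → Set kap.ord.ToType)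
    (hF : ∀ i, #(F i) < mu) :
    ∃ α, ∀ β, ∀ᶠ i in (D : Filter I), ∀ x ∈ F i, α ≤ x → β ≤ x := by
  by_contra! h
  have h' : ∀ α, ∃ β, ∀ᶠ i in (D : Filter I), ∃ x ∈ F i, α ≤ x ∧ x < β := by
    intro α
    obtain ⟨β, hβ⟩ := h α
    exact ⟨β, by simpa [Ultrafilter.frequently_iff_eventually] using hβ⟩
  choose b hb using h'
  have := nonempty_ord_toType hkap.pos.ne'
  obtain ⟨a, -, ha⟩ := exists_seq_of_forall_exists (T := kap.ord.ToType) (X := kap.ord.ToType)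
    (Q := fun _ => True) (R := fun x y => b x ≤ y) fun t d _ _ => by
      obtain ⟨x, hx⟩ := exists_forall_lt_of_isRegular hkap (mk_Iio_toType_lt t)
        fun s : Iio t => b (d s)
      exact ⟨x, trivial, fun s hs => (hx ⟨s, hs⟩).le⟩
  refine hD (IsRegularOn.isRegularUltrafilter (A := kap.ord.ToType)
    ⟨fun i => {t | ∃ x ∈ F i, a t ≤ x ∧ x < b (a t)}, fun i => ?_, fun t => hb (a t)⟩
    (mk_ord_toType kap).ge)
  refine lt_of_le_of_lt ?_ (hF i)
  have hex : ∀ t : {t | ∃ x ∈ F i, a t ≤ x ∧ x < b (a t)}, ∃ x ∈ F i, a t ≤ x ∧ x < b (a t) :=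
    fun t => t.2
  choose x hx hax hxb using hex
  refine mk_le_of_injective (f := fun t => (⟨x t, hx t⟩ : F i)) fun s t hst => ?_
  have hst' : x s = x t := congrArg Subtype.val hst
  rcases lt_trichotomy s.1 t.1 with hlt | heq | hlt
  · exact absurd ((hxb s).trans_le ((ha _ _ hlt).trans (hax t))) (by simp [hst'])
  · exact Subtype.ext heq
  · exact absurd ((hxb t).trans_le ((ha _ _ hlt).trans (hax s))) (by simp [hst'])

/-- A decreasing sequence in a well-order is finite. -/
theorem finite_of_strictAntiOn {T K : Type*} [LinearOrder T] [LinearOrder K] [WellFoundedLT K]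
    [WellFoundedLT T] {s : Set T} {g : T → K} (hg : StrictAntiOn g s) : s.Finite := by
  by_contra hs
  have := Set.infinite_coe_iff.2 hs
  obtain ⟨φ, hφ | hφ⟩ := Infinite.exists_strictMono_or_strictAnti s
  · exact not_strictAnti_of_wellFoundedLT (fun n => g (φ n))
      fun m n hmn => hg (φ m).2 (φ n).2 (hφ hmn)
  · exact not_strictAnti_of_wellFoundedLT φ hφ

/-- **Kanamori's theorem on least functions.** Let `kap` be regular and `lam < kap`. If `D` is
neither `(ℵ₀, kap)`- nor `(ℵ₀, lam)`-regular and some function is above all constants, then modulo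
`D` there is a least such function.

Otherwise there are functions `g t`, `t < lam`, above all constants, and sets `A t ∈ D` such that
modulo a threshold, `g s i > g t i` whenever `s < t` and `i ∈ A s ∩ A t`. For each `i` only
finitely many `t` can then satisfy `i ∈ A t`, so that the sets `A t` witness
`(ℵ₀, lam)`-regularity. -/
theorem exists_least_isAboveConstants {lam kap : Cardinal.{u}}
    (hkap : kap.IsRegular) (hlt : lam < kap)
    (hD : ¬ IsRegularUltrafilter D ℵ₀ kap) (hD' : ¬ IsRegularUltrafilter D ℵ₀ lam)
    {g₀ : I → kap.ord.ToType} (hg₀ : IsAboveConstants D g₀) :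
    ∃ g : I → kap.ord.ToType, IsAboveConstants D g ∧
      ∀ g', IsAboveConstants D g' → ∀ᶠ i in (D : Filter I), g i ≤ g' i := by
  classical
  by_contra! hno
  have hstep : ∀ g : I → kap.ord.ToType, IsAboveConstants D g →
      ∃ g', IsAboveConstants D g' ∧ ∀ᶠ i in (D : Filter I), g' i < g i := by
    intro g hg
    obtain ⟨g', hg', h⟩ := hno g hg
    exact ⟨g', hg', by simpa [Ultrafilter.frequently_iff_eventually] using h⟩
  have := nonempty_ord_toType hkap.pos.ne'
  -- The recursion produces triples `(g t, α t, A t)`, with `α t` the threshold.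
  obtain ⟨d, hd, hdd⟩ := exists_seq_of_forall_exists (T := lam.ord.ToType)
    (X := (I → kap.ord.ToType) × kap.ord.ToType × Set I)
    (Q := fun x => IsAboveConstants D x.1 ∧ x.2.2 ∈ D)
    (R := fun x y => x.2.1 ≤ y.2.1 ∧ ∀ i, i ∈ x.2.2 → i ∈ y.2.2 → y.2.1 ≤ x.1 i → y.1 i < x.1 i)
    fun t d hd hdd => by
      obtain ⟨a₀, ha₀⟩ := exists_forall_lt_of_isRegular hkap ((mk_Iio_toType_lt t).trans hlt)
        fun s : Iio t => (d s).2.1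
      let S : I → Set lam.ord.ToType := fun i => {s | s < t ∧ i ∈ (d s).2.2 ∧ a₀ ≤ (d s).1 i}
      have hS : ∀ i, (S i).Finite := fun i => by
        refine finite_of_strictAntiOn (g := fun s => (d s).1 i) ?_
        intro r hr s hs hrs
        exact (hdd s hs.1 r hrs).2 i hr.2.1 hs.2.1 ((ha₀ ⟨s, hs.1⟩).le.trans hr.2.2)
      let F : I → Set kap.ord.ToType := fun i => (fun s => (d s).1 i) '' S i
      have hF : ∀ i, (F i).Finite := fun i => (hS i).image _
      obtain ⟨a₁, ha₁⟩ := exists_forall_eventually_le_of_not_isRegularUltrafilter hkap hD F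
        fun i => lt_aleph0_iff_set_finite.2 (hF i)
      let a := max a₀ a₁
      -- `m i` is the least element of `F i` above the threshold.
      have hm : ∀ i, ∃ m : kap.ord.ToType, (∀ x ∈ F i, a ≤ x → m ≤ x) ∧
          (m = g₀ i ∨ m ∈ F i ∧ a ≤ m) := by
        intro i
        rcases ({x ∈ F i | a ≤ x} : Set _).eq_empty_or_nonempty with h | h
        · refine ⟨g₀ i, fun x hx hax => ?_, Or.inl rfl⟩
          exact absurd (show x ∈ {x ∈ F i | a ≤ x} from ⟨hx, hax⟩) (by simp [h])
        · refine ⟨wellFounded_lt.min _ h, fun x hx hax => ?_, Or.inr (wellFounded_lt.min_mem _ h)⟩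
          exact not_lt.1 (wellFounded_lt.not_lt_min _ (show x ∈ {x ∈ F i | a ≤ x} from ⟨hx, hax⟩))
      choose m hm hm' using hm
      have := noMaxOrder hkap.1
      have hmU : IsAboveConstants D m := by
        intro β
        obtain ⟨β', hβ'⟩ := exists_gt β
        filter_upwards [hg₀ β, ha₁ β'] with i h1 h2
        rcases hm' i with h | ⟨h, h'⟩
        · rwa [h]
        · exact hβ'.trans_le (h2 _ h ((le_max_right _ _).trans h'))
      obtain ⟨g, hg, hgm⟩ := hstep m hmU
      refine ⟨(g, a, {i | g i < m i}), ⟨hg, hgm⟩, fun s hs =>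
        ⟨(ha₀ ⟨s, hs⟩).le.trans (le_max_left _ _), fun i his hi hai => ?_⟩⟩
      exact lt_of_lt_of_le hi (hm i _ ⟨s, ⟨hs, his, (le_max_left _ _).trans hai⟩, rfl⟩ hai)
  obtain ⟨a, ha⟩ := exists_forall_lt_of_isRegular hkap (ι := lam.ord.ToType)
    (by rwa [mk_ord_toType]) fun s => (d s).2.1
  refine hD' (IsRegularOn.isRegularUltrafilter (A := lam.ord.ToType)
    ⟨fun i => {t | i ∈ (d t).2.2 ∧ a ≤ (d t).1 i}, fun i => ?_, fun t => ?_⟩ (mk_ord_toType lam).ge)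
  · refine lt_aleph0_iff_set_finite.2 (finite_of_strictAntiOn (g := fun s => (d s).1 i) ?_)
    intro r hr s hs hrs
    exact (hdd s r hrs).2 i hr.1 hs.1 ((ha s).le.trans hr.2)
  · filter_upwards [(hd t).2, (hd t).1 a] with i h1 h2 using ⟨h1, h2.le⟩

/-- An `(ℵ₀, lam)`-regular ultrafilter is `lam`-decomposable, as there are only `lam` finite subsets
of `lam`. -/
theorem IsRegularUltrafilter.isDecomposable {lam : Cardinal.{u}} (hlam : ℵ₀ < lam)
    (h : IsRegularUltrafilter D ℵ₀ lam) : IsDecomposable D lam := by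
  by_contra hD
  obtain ⟨f, hf⟩ := h
  have hfin : ∀ i, (f i).1.Finite := fun i => lt_aleph0_iff_set_finite.1 (f i).2
  have : Infinite lam.ord.ToType := infinite_iff.2 (by simpa using hlam.le)
  obtain ⟨X, hX, hX'⟩ := exists_eventually_mem_of_not_isDecomposable hD
    (A := Finset lam.ord.ToType) (by simp) fun i => (hfin i).toFinset
  have hU : #(⋃ x : X, (x.1 : Set lam.ord.ToType)) < lam := by
    refine (mk_iUnion_le_sum_mk.trans (sum_le_sum _ (fun _ => ℵ₀) fun x => ?_)).trans_lt ?_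
    · exact (lt_aleph0_iff_set_finite.2 x.1.finite_toSet).le
    · rw [sum_const']
      exact mul_lt_of_lt hlam.le hX hlam
  obtain ⟨t, ht⟩ : ∃ t, t ∉ ⋃ x : X, (x.1 : Set lam.ord.ToType) := by
    by_contra! h
    rw [eq_univ_of_forall h, mk_univ, mk_ord_toType] at hU
    exact hU.false
  have hcontra : ∀ᶠ i in (D : Filter I), False := by
    filter_upwards [hX', hf t] with i h1 h2
    exact ht (mem_iUnion.2 ⟨⟨_, h1⟩, by simpa using h2⟩)
  exact D.neBot.ne (eventually_false_iff_eq_bot.1 hcontra)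

/-! ### Possible cofinalities -/

theorem exists_monotone_isCofinal_range {α : Type u} [LinearOrder α] [WellFoundedLT α]
    {c : Cardinal.{u}} (hc : cof α = c) :
    ∃ k : c.ord.ToType → α, Monotone k ∧ IsCofinal (range k) := by
  subst hc
  obtain ⟨s, hs, hs'⟩ := Ordinal.exists_ord_cof_eq α
  rw [← Ordinal.type_toType (cof α).ord, Ordinal.type_eq] at hs'
  obtain ⟨e⟩ := hs'
  let e' : s ≃o (cof α).ord.ToType := OrderIso.ofRelIsoLT e
  refine ⟨fun x => (e'.symm x).1, fun x y h => e'.symm.monotone h, fun a => ?_⟩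
  obtain ⟨b, hb, hab⟩ := hs a
  exact ⟨b, ⟨e' ⟨b, hb⟩, by simp⟩, hab⟩

theorem isRegular_cof_of_noMaxOrder {α : Type u} [LinearOrder α] [WellFoundedLT α] [Nonempty α]
    [NoMaxOrder α] : (cof α).IsRegular :=
  ⟨aleph0_le_cof, (cof_ord_cof α).ge⟩

/-- Below a least function above all constants, the constants are cofinal. -/
theorem exists_eventually_lt_of_least {kap : Cardinal.{u}} (hkap : ℵ₀ ≤ kap)
    {g : I → kap.ord.ToType}
    (hleast : ∀ g', IsAboveConstants D g' → ∀ᶠ i in (D : Filter I), g i ≤ g' i)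
    {b : I → kap.ord.ToType} (hb : ∀ᶠ i in (D : Filter I), b i < g i) :
    ∃ α, ∀ᶠ i in (D : Filter I), b i < α := by
  by_contra! h
  have := noMaxOrder hkap
  have hU : IsAboveConstants D b := fun α => by
    obtain ⟨α', hα'⟩ := exists_gt α
    have h' : ∀ᶠ i in (D : Filter I), α' ≤ b i := by
      simpa [Ultrafilter.frequently_iff_eventually] using h α'
    exact h'.mono fun i hi => hα'.trans_le hi
  obtain ⟨i, h1, h2⟩ := (hb.and (hleast b hU)).exists
  exact absurd h1 (not_lt.2 h2)

/-- The element of the ultraproduct represented by `x`. -/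
def toProduct {ι : Type v} (D : Ultrafilter ι) {A : ι → Type u} (x : ∀ i, A i) :
    (D : Filter ι).Product A :=
  Quotient.mk _ x

theorem exists_toProduct_eq {ι : Type v} {D : Ultrafilter ι} {A : ι → Type u}
    (z : (D : Filter ι).Product A) : ∃ x, toProduct D x = z :=
  Quotient.exists_rep z

theorem toProduct_le_toProduct {ι : Type v} {D : Ultrafilter ι} {A : ι → Type u}
    [∀ i, Preorder (A i)] {x y : ∀ i, A i} :
    toProduct D x ≤ toProduct D y ↔ ∀ᶠ i in (D : Filter ι), x i ≤ y i :=
  Iff.rfl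

/-- Let `g` be the least function above all constants, and let its cofinalities be given by a
function `v` into a set `a` of regular cardinals, unbounded in `lam` modulo `D`. If `D` is not
`lam`-decomposable, then functions in `∏_D v i` take fewer than `lam` values, so they are dominated
by functions on `a`. Consequently the ultraproduct of `a` modulo the image of `D` has the same
cofinality as `∏_D v i`, that is, as the constants below `g`, which is `kap`. -/
theorem mem_pcf_of_least {lam kap : Cardinal.{u}} (hkap : kap.IsRegular)
    (hD : ¬ IsDecomposable D lam) {g : I → kap.ord.ToType} (hg : IsAboveConstants D g)
    (hleast : ∀ g', IsAboveConstants D g' → ∀ᶠ i in (D : Filter I), g i ≤ g' i)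
    {a : Set Cardinal.{u}} (ha : ∀ c ∈ a, c.IsRegular) (ha' : ∀ c ∈ a, c < lam)
    (v : I → a) (hv : ∀ᶠ i in (D : Filter I), cof (Iio (g i)) = (v i).1)
    (hunb : ∀ c < lam, ∀ᶠ i in (D : Filter I), c < (v i).1) : kap ∈ pcf a := by
  have hne := nonempty_ord_toType hkap.pos.ne'
  have hnea : ∀ c : a, Nonempty c.1.ord.ToType := fun c => nonempty_ord_toType (ha c.1 c.2).pos.ne'
  obtain ⟨k, hk⟩ : ∃ k : ∀ i, (v i).1.ord.ToType → kap.ord.ToType, ∀ᶠ i in (D : Filter I),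
      Monotone (k i) ∧ (∀ x, k i x < g i) ∧ ∀ b < g i, ∃ x, b ≤ k i x := by
    refine (skolem (P := fun i (k : (v i).1.ord.ToType → kap.ord.ToType) =>
      Monotone k ∧ (∀ x, k x < g i) ∧ ∀ b < g i, ∃ x, b ≤ k x)).1 (hv.mono fun i hi => ?_)
    obtain ⟨k, hk, hk'⟩ := exists_monotone_isCofinal_range hi
    refine ⟨fun x => (k x).1, fun x y h => hk h, fun x => (k x).2, fun b hb => ?_⟩
    obtain ⟨_, ⟨x, rfl⟩, hx⟩ := hk' ⟨b, hb⟩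
    exact ⟨x, hx⟩
  have hr : ∀ α, ∃ r : ∀ i, (v i).1.ord.ToType, ∀ᶠ i in (D : Filter I), α ≤ k i (r i) := by
    intro α
    refine (skolem (P := fun i (x : (v i).1.ord.ToType) => α ≤ k i x)).1 ?_
    filter_upwards [hk, hg α] with i h1 h2 using h1.2.2 α h2
  choose r hr using hr
  have hemb : ∀ c : a, Nonempty (c.1.ord.ToType ↪ lam.ord.ToType) := fun c =>
    (Cardinal.le_def _ _).1 (by simpa using (ha' c.1 c.2).le)
  let emb : ∀ c : a, c.1.ord.ToType ↪ lam.ord.ToType := fun c => (hemb c).some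
  choose Y hY hY' using fun α => exists_eventually_mem_of_not_isDecomposable hD
    (mk_ord_toType lam).le fun i => emb (v i) (r α i)
  -- `q α c` bounds all possible values of `r α` in `c`.
  have hq : ∀ α (c : a), ∃ q, #(Y α) < c.1 → ∀ x, emb c x ∈ Y α → x ≤ q := by
    intro α c
    by_cases h : #(Y α) < c.1
    · obtain ⟨b, hb⟩ := exists_forall_lt_of_mk_lt_cof (c := c.1) (s := emb c ⁻¹' Y α) (by
        rw [(ha c.1 c.2).cof_ord]
        exact (mk_preimage_of_injective _ _ (emb c).injective).trans_lt h)
      exact ⟨b, fun _ x hx => (hb x hx).le⟩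
    · exact ⟨Classical.arbitrary _, fun h' => absurd h' h⟩
  choose q hq using hq
  have hrq : ∀ α, ∀ᶠ i in (D : Filter I), r α i ≤ q α (v i) := fun α => by
    filter_upwards [hY' α, hunb _ (hY α)] with i h1 h2 using hq α (v i) h2 _ h1
  have hbdd : ∀ x : ∀ c : a, c.1.ord.ToType, ∃ α, ∀ᶠ i in (D : Filter I), k i (x (v i)) < α :=
    fun x => exists_eventually_lt_of_least hkap.1 hleast (hk.mono fun i hi => hi.2.1 _)
  refine ⟨ha, D.map v, le_antisymm ?_ ?_⟩
  · refine le_cof_iff.2 fun s hs => ?_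
    by_contra! hlt
    choose x hx using fun z : s => exists_toProduct_eq z.1
    choose b hb using fun z : s => hbdd (x z)
    have hsmall : #(range b) < kap := by
      have h1 := mk_range_le_lift (f := b)
      rw [← Cardinal.lift_lt.{u, u + 1}]
      rw [lift_id'.{u, u + 1}] at h1
      exact h1.trans_lt hlt
    obtain ⟨β, hβ⟩ := exists_forall_lt_of_mk_lt_cof (s := range b) (by rwa [hkap.cof_ord])
    obtain ⟨z, hz, hqz⟩ := hs (toProduct _ (q β))
    have hxz : toProduct _ (x ⟨z, hz⟩) = z := hx ⟨z, hz⟩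
    rw [← hxz, toProduct_le_toProduct] at hqz
    have hqv : ∀ᶠ i in (D : Filter I), q β (v i) ≤ x ⟨z, hz⟩ (v i) := eventually_map.1 hqz
    obtain ⟨i, h1, h2, h3, h4, h5⟩ :=
      (hqv.and ((hrq β).and ((hr β).and (hk.and (hb ⟨z, hz⟩))))).exists
    exact absurd (hβ _ (mem_range_self ⟨z, hz⟩))
      (not_lt.2 ((h3.trans (h4.1 (h2.trans h1))).trans h5.le))
  · refine (cof_le (s := range fun α => toProduct (D.map v) (q α)) fun z => ?_).trans ?_
    · obtain ⟨x, rfl⟩ := exists_toProduct_eq z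
      obtain ⟨α, hα⟩ := hbdd x
      refine ⟨_, mem_range_self α, ?_⟩
      rw [toProduct_le_toProduct, Ultrafilter.coe_map, eventually_map]
      filter_upwards [hα, hr α, hrq α, hk] with i h1 h2 h3 h4
      refine le_trans (le_of_lt (lt_of_not_ge fun h => ?_)) h3
      exact absurd (h2.trans (h4.1 h)) (not_le.2 h1)
    · have h1 := mk_range_le_lift (f := fun α => toProduct (D.map v) (q α))
      rwa [lift_id'.{u, u + 1}, mk_ord_toType] at h1

/-- The set in question consists of the cofinalities of the values of the least function above all
constants. -/
theorem exists_mem_pcf {lam kap : Cardinal.{u}} (hlam : lam.IsSingular) (hkap : kap.IsRegular)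
    (hlt : lam < kap) (hreg : IsRegularUltrafilter D (succ lam) kap)
    (hD : ¬ IsDecomposable D lam)
    (hnreg : ∀ mu : Cardinal.{u}, ℵ₀ ≤ mu → mu < lam → ¬ IsRegularUltrafilter D mu kap) :
    ∃ a : Set Cardinal.{u}, (∀ c ∈ a, c < lam) ∧ #a < Cardinal.lift.{u + 1} lam ∧ IsLUB a lam ∧
      kap ∈ pcf a := by
  have hlim := hlam.isSuccLimit
  have hℵ : ℵ₀ < lam := hlam.aleph0_le.lt_of_ne fun h => not_isSingular_aleph0 (h ▸ hlam)
  have hnomax := noMaxOrder hkap.1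
  obtain ⟨f, -, hfc, -, hf⟩ := exists_injOn_of_isRegularUltrafilter hlam.pos.ne' hreg
  choose g₀ hg₀ using fun i => exists_forall_lt_of_mk_lt_cof (s := f i)
    (by rw [hkap.cof_ord]; exact (hfc i).trans_lt hlt)
  obtain ⟨g, hg, hleast⟩ := exists_least_isAboveConstants hkap hlt (hnreg _ le_rfl hℵ)
    (fun h => hD (h.isDecomposable hℵ)) (g₀ := g₀)
    fun α => (hf α).mono fun i hi => hg₀ i α hi
  have hbdd : ∀ b : I → kap.ord.ToType, (∀ᶠ i in (D : Filter I), b i < g i) →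
      ∃ α, ∀ᶠ i in (D : Filter I), b i < α :=
    fun b => exists_eventually_lt_of_least hkap.1 hleast
  -- Modulo `D`, the set `f i` is cofinal below `g i`, as `g` is least.
  have hcofinal : ∀ᶠ i in (D : Filter I), ∀ b < g i, ∃ x ∈ f i, x < g i ∧ b < x := by
    by_contra h
    rw [← Ultrafilter.eventually_not] at h
    push Not at h
    obtain ⟨b, hb⟩ := h.choice
    obtain ⟨α, hα⟩ := hbdd b (hb.mono fun i hi => hi.1)
    obtain ⟨i, h1, h2, h3, h4⟩ := (hb.and (hα.and ((hf α).and (hg α)))).exists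
    exact absurd (h1.2 α h3 h4) (not_le.2 h2)
  have hregu : ∀ᶠ i in (D : Filter I), (cof (Iio (g i))).IsRegular ∧ cof (Iio (g i)) < lam := by
    obtain ⟨α⟩ := nonempty_ord_toType hkap.pos.ne'
    filter_upwards [hcofinal, hg α] with i h1 h2
    have : Nonempty (Iio (g i)) := ⟨⟨α, h2⟩⟩
    have : NoMaxOrder (Iio (g i)) := ⟨fun b => by
      obtain ⟨x, -, hx, hbx⟩ := h1 b.1 b.2
      exact ⟨⟨x, hx⟩, hbx⟩⟩
    have hregc := isRegular_cof_of_noMaxOrder (α := Iio (g i))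
    refine ⟨hregc, lt_of_le_of_ne ?_ fun h => hlam.not_isRegular (h ▸ hregc)⟩
    refine (cof_le (s := Subtype.val ⁻¹' f i) fun b => ?_).trans
      ((mk_preimage_of_injective _ _ Subtype.val_injective).trans (hfc i))
    obtain ⟨x, hxf, hx, hbx⟩ := h1 b.1 b.2
    exact ⟨⟨x, hx⟩, hxf, hbx.le⟩
  have hunb : ∀ c < lam, ∀ᶠ i in (D : Filter I), c < cof (Iio (g i)) := by
    intro c hc
    by_contra h
    rw [← Ultrafilter.eventually_not] at h
    have hk : ∀ᶠ i in (D : Filter I), ∃ s : Set kap.ord.ToType, #s ≤ c ∧ (∀ x ∈ s, x < g i) ∧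
        ∀ b < g i, ∃ x ∈ s, b ≤ x := by
      filter_upwards [h] with i hi
      obtain ⟨s, hs, hs'⟩ := exists_cof_eq (α := Iio (g i))
      refine ⟨Subtype.val '' s, mk_image_le.trans (hs'.le.trans (not_lt.1 hi)), ?_, ?_⟩
      · rintro _ ⟨x, -, rfl⟩
        exact x.2
      · intro b hb
        obtain ⟨x, hx, hbx⟩ := hs ⟨b, hb⟩
        exact ⟨x.1, mem_image_of_mem _ hx, hbx⟩
    obtain ⟨s, hs⟩ := hk.choice
    classical
    obtain ⟨α, hα⟩ := exists_forall_eventually_le_of_not_isRegularUltrafilter hkap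
      (hnreg (succ (max c ℵ₀)) ((le_max_right _ _).trans (le_succ _))
        (hlim.succ_lt (max_lt hc hℵ)))
      (fun i => if #(s i) ≤ c then s i else ∅) (fun i => lt_succ_iff.2 (by
        split_ifs with h
        · exact le_max_of_le_left h
        · simp))
    have hx : ∀ᶠ i in (D : Filter I), ∃ x, x ∈ s i ∧ x < g i ∧ α ≤ x := by
      filter_upwards [hs, hg α] with i h1 h2
      obtain ⟨x, hx, hαx⟩ := h1.2.2 α h2
      exact ⟨x, hx, h1.2.1 x hx, hαx⟩
    obtain ⟨x, hx⟩ := hx.choice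
    obtain ⟨β, hβ⟩ := hbdd x (hx.mono fun i hi => hi.2.1)
    obtain ⟨i, h1, h2, h3, h4⟩ := (hs.and (hx.and (hβ.and (hα β)))).exists
    rw [if_pos h1.1] at h4
    exact absurd h3 (not_lt.2 (h4 _ h2.1 h2.2.2))
  -- By indecomposability the cofinalities below `g i` take fewer than `lam` values modulo `D`.
  have hiota : ∀ᶠ i in (D : Filter I), ∃ t : lam.ord.ToType, #(Iio t) = cof (Iio (g i)) :=
    hregu.mono fun i hi => exists_mk_Iio_eq hi.2
  obtain ⟨w, hw⟩ := hiota.choice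
  obtain ⟨X, hX, hX'⟩ := exists_eventually_mem_of_not_isDecomposable hD (mk_ord_toType lam).le w
  let a : Set Cardinal.{u} := {c | c.IsRegular ∧ ∃ t ∈ X, #(Iio t) = c}
  have hmem : ∀ᶠ i in (D : Filter I), cof (Iio (g i)) ∈ a := by
    filter_upwards [hregu, hw, hX'] with i h1 h2 h3 using ⟨h1.1, w i, h3, h2⟩
  have halt : ∀ c ∈ a, c < lam := by
    rintro _ ⟨-, t, -, rfl⟩
    exact mk_Iio_toType_lt t
  refine ⟨a, halt, ?_, ⟨fun c hc => (halt c hc).le, fun c hc => ?_⟩, ?_⟩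
  · have h1 : a ⊆ (fun t => #(Iio t)) '' X := by
      rintro c ⟨-, t, ht, rfl⟩
      exact mem_image_of_mem _ ht
    have h2 := mk_image_le_lift (f := fun t : lam.ord.ToType => #(Iio t)) (s := X)
    refine (mk_le_mk_of_subset h1).trans_lt ?_
    refine lt_of_le_of_lt ?_ (Cardinal.lift_lt.{u, u + 1}.2 hX)
    rwa [lift_id'.{u, u + 1}] at h2
  · by_contra! hcl
    obtain ⟨i, h1, h2⟩ := ((hunb c hcl).and hmem).exists
    exact absurd (hc h2) (not_le.2 h1)
  · obtain ⟨v, hv⟩ : ∃ v : I → a, ∀ᶠ i in (D : Filter I), cof (Iio (g i)) = (v i).1 := by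
      have : ∀ᶠ i in (D : Filter I), ∃ c : a, cof (Iio (g i)) = c.1 :=
        hmem.mono fun i hi => ⟨⟨_, hi⟩, rfl⟩
      exact this.choice
    refine mem_pcf_of_least hkap hD hg hleast (fun c hc => hc.1) halt v hv fun c hc => ?_
    filter_upwards [hunb c hc, hv] with i h1 h2
    rwa [← h2]

/-! ### The strong limit case -/

theorem power_lt_of_isStrongLimit {lam a b : Cardinal.{u}} (hsl : lam.IsStrongLimit)
    (hℵ : ℵ₀ < lam) (ha : a < lam) (hb : b < lam) : a ^ b < lam := by
  have hs : max a (max b ℵ₀) < lam := max_lt ha (max_lt hb hℵ)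
  have hℵs : ℵ₀ ≤ max a (max b ℵ₀) := by simp
  calc a ^ b ≤ max a (max b ℵ₀) ^ b := power_le_power_right (le_max_left _ _)
    _ ≤ max a (max b ℵ₀) ^ max a (max b ℵ₀) :=
      power_le_power_left (aleph0_pos.trans_le hℵs).ne' (by simp)
    _ = 2 ^ max a (max b ℵ₀) := power_self_eq hℵs
    _ < lam := hsl.isStrongPrelimit hs

theorem mk_sigma_toType_le {lam : Cardinal.{u}} (hlam : ℵ₀ ≤ lam) {B : lam.ord.ToType → Type u}
    (hB : ∀ t, #(B t) ≤ lam) : #(Σ t, B t) ≤ lam := by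
  rw [mk_sigma]
  refine (sum_le_sum _ (fun _ => lam) hB).trans ?_
  rw [sum_const', mk_ord_toType]
  exact mul_le_of_le hlam le_rfl le_rfl

/-- If `lam` is a strong limit and some `H : I → lam` is above all constants, then
`lam`-indecomposability gives `rho < lam` such that every function into `lam` takes, modulo `D`, at
most `rho` values. Otherwise there are functions `p t` into `lam` not taking `#t` values; since
there are at most `lam` functions from a bounded part of `lam` to itself, the sequence of all `p t`
truncated at `H i` can be coded by a single function into `lam`, and from a small set containing the
codes one recovers too small a set of values for some `p t`. -/
theorem exists_forall_exists_mk_le {lam : Cardinal.{u}} (hsl : lam.IsStrongLimit) (hℵ : ℵ₀ < lam)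
    (hD : ¬ IsDecomposable D lam) {H : I → lam.ord.ToType}
    (hH : ∀ t, ∀ᶠ i in (D : Filter I), t < H i) :
    ∃ rho < lam, ∀ (B : Type u), #B ≤ lam → ∀ p : I → B,
      ∃ X : Set B, #X ≤ rho ∧ ∀ᶠ i in (D : Filter I), p i ∈ X := by
  suffices h : ∃ rho < lam, ∀ p : I → lam.ord.ToType,
      ∃ X : Set lam.ord.ToType, #X ≤ rho ∧ ∀ᶠ i in (D : Filter I), p i ∈ X by
    obtain ⟨rho, hrho, h⟩ := h
    refine ⟨rho, hrho, fun B hB p => ?_⟩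
    rw [← mk_ord_toType lam] at hB
    obtain ⟨ε⟩ := hB
    obtain ⟨X, hX, hX'⟩ := h (ε ∘ p)
    exact ⟨ε ⁻¹' X, (mk_preimage_of_injective _ _ ε.injective).trans hX, hX'⟩
  by_contra! h
  classical
  choose p hp using fun t => h _ (mk_Iio_toType_lt t)
  choose X hX hX' using fun t => exists_eventually_mem_of_not_isDecomposable hD
    (mk_ord_toType lam).le (p t)
  -- After the injection `ε t`, the values of `p t` are bounded by `x t`.
  have hε : ∀ t, ∃ (x : lam.ord.ToType) (ε : lam.ord.ToType → lam.ord.ToType),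
      InjOn ε (X t) ∧ ∀ y ∈ X t, ε y < x := by
    intro t
    obtain ⟨x, hx⟩ := exists_mk_Iio_eq (hX t)
    obtain ⟨E⟩ := Cardinal.eq.1 hx
    refine ⟨x, fun y => if hy : y ∈ X t then (E.symm ⟨y, hy⟩).1 else x, ?_, fun y hy => ?_⟩
    · intro y hy z hz hyz
      simp only [dif_pos hy, dif_pos hz] at hyz
      simpa using E.symm.injective (Subtype.ext hyz)
    · simp only [dif_pos hy]
      exact (E.symm ⟨y, hy⟩).2
  choose x ε hε hεx using hε
  let C : Type u := Σ t : lam.ord.ToType, (Iio t → Iio t)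
  have hC : #C ≤ lam := mk_sigma_toType_le hℵ.le fun t => by
    rw [← power_def]
    exact (power_lt_of_isStrongLimit hsl hℵ (mk_Iio_toType_lt t) (mk_Iio_toType_lt t)).le
  let F : I → C := fun i => ⟨H i, fun s =>
    if hs : ε s.1 (p s.1 i) < H i then ⟨ε s.1 (p s.1 i), hs⟩ else s⟩
  obtain ⟨Z, hZ, hZ'⟩ := exists_eventually_mem_of_not_isDecomposable hD hC F
  obtain ⟨t, ht⟩ := exists_mk_Iio_eq hZ
  let dec : C → lam.ord.ToType := fun y => if hy : t < y.1 then (y.2 ⟨t, hy⟩).1 else t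
  have hsmall := hp t {y | y ∈ X t ∧ ε t y ∈ dec '' Z}
    ((mk_sep_le_of_injOn (hε t) _).trans (mk_image_le.trans ht.ge))
  obtain ⟨i, h0, h1, h2, h3, h4⟩ :=
    (hsmall.and ((hX' t).and (hZ'.and ((hH t).and (hH (x t)))))).exists
  refine h0 ⟨h1, F i, h2, ?_⟩
  have h5 : ε t (p t i) < H i := (hεx t _ h1).trans h4
  simp [dec, F, h3, h5]

/-- Equality modulo `D` of the members of a family of functions. -/
def eventuallyEqSetoid (D : Ultrafilter I) {A : Type*} {B : Type*} (p : A → I → B) : Setoid A where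
  r a b := ∀ᶠ i in (D : Filter I), p a i = p b i
  iseqv := ⟨fun _ => Eventually.of_forall fun _ => rfl, fun h => h.mono fun _ h' => h'.symm,
    fun h h' => (h.and h').mono fun _ h'' => h''.1.trans h''.2⟩

/-- If functions into sets of size at most `lam` take at most `rho < lam` values modulo `D`, then
any family of functions into a set of size `< lam` has fewer than `lam` members modulo `D`:
fewer than `lam` of them are, modulo `D`, all induced by a single function with `rho` values. -/
theorem mk_quotient_eventuallyEqSetoid_lt {lam rho : Cardinal.{u}} (hsl : lam.IsStrongLimit)
    (hℵ : ℵ₀ < lam) (hrho : rho < lam)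
    (hval : ∀ (B : Type u), #B ≤ lam → ∀ p : I → B,
      ∃ X : Set B, #X ≤ rho ∧ ∀ᶠ i in (D : Filter I), p i ∈ X)
    {A B : Type u} (hB : #B < lam) (p : A → I → B) :
    #(Quotient (eventuallyEqSetoid D p)) < lam := by
  by_contra! h
  have h1 : max #B 1 ^ rho < lam :=
    power_lt_of_isStrongLimit hsl hℵ (max_lt hB (one_lt_aleph0.trans hℵ)) hrho
  have h2 : succ (max #B 1 ^ rho) < lam := hsl.isSuccLimit.succ_lt h1
  obtain ⟨Q, hQ⟩ := le_mk_iff_exists_set.1 (h2.le.trans h)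
  obtain ⟨Y, hY, hY'⟩ := hval (Q → B) (by
    rw [← power_def, hQ]
    exact (power_lt_of_isStrongLimit hsl hℵ hB h2).le) fun i q => p q.1.out i
  have hinj : Function.Injective fun (q : Q) (y : Y) => y.1 q := by
    intro q r hqr
    refine Subtype.ext ?_
    rw [← Quotient.out_equiv_out]
    filter_upwards [hY'] with i hi
    exact congrFun hqr ⟨_, hi⟩
  have h3 := mk_le_of_injective hinj
  rw [hQ, ← power_def] at h3
  refine absurd h3 (not_le.2 (lt_succ_iff.2 ?_))
  exact (power_le_power_right (le_max_left _ _)).trans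
    (power_le_power_left (zero_lt_one.trans_le (le_max_right _ _)).ne' hY)

/-- In the strong limit case, coding subsets of `kap` by functions into `lam` shows
`2 ^ kap ≤ cf S_lam(lam) * lam` for a `(lam⁺, kap)`-regular, `lam`-indecomposable ultrafilter for
which some function into `lam` is above all constants. The functions coding `φ ⊆ kap` map `i` to the
trace of `φ` on the points of `f i` enumerated below a bound `w i`, for `w` in a family of fewer
than `lam` functions bounding the enumerations of all points. -/
theorem isDecomposable_of_isStrongLimit {lam kap : Cardinal.{u}} (hlam : lam.IsSingular)
    (hsl : lam.IsStrongLimit) (hlt : lam < kap) (hreg : IsRegularUltrafilter D (succ lam) kap)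
    {H : I → lam.ord.ToType} (hH : ∀ t, ∀ᶠ i in (D : Filter I), t < H i)
    (hcof : cof (SmallSubsets lam lam) < 2 ^ kap) : IsDecomposable D lam := by
  classical
  by_contra hD
  have hℵ : ℵ₀ < lam := hlam.aleph0_le.lt_of_ne fun h => not_isSingular_aleph0 (h ▸ hlam)
  have := noMaxOrder hlam.aleph0_le
  obtain ⟨rho, hrho, hval⟩ := exists_forall_exists_mk_le hsl hℵ hD hH
  obtain ⟨f, e, -, he, hf⟩ := exists_injOn_of_isRegularUltrafilter hlam.pos.ne' hreg
  obtain ⟨J, hJ, hJ'⟩ := exists_cof_eq (α := lam.ord.ToType)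
  rw [Ordinal.cof_toType] at hJ'
  have hJlam : #J < lam := hJ'.trans_lt hlam.cof_ord_lt
  have hup : ∀ t : lam.ord.ToType, ∃ s : J, t < s.1 := fun t => by
    obtain ⟨t', ht'⟩ := exists_gt t
    obtain ⟨s, hs, hts⟩ := hJ t'
    exact ⟨⟨s, hs⟩, ht'.trans_le hts⟩
  choose up hup using hup
  let j : kap.ord.ToType → I → J := fun α i => up (e i α)
  let W : Type u := Quotient (eventuallyEqSetoid D j)
  have hW : #W < lam := mk_quotient_eventuallyEqSetoid_lt hsl hℵ hrho hval hJlam j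
  let w : W → I → lam.ord.ToType := fun x i => (j x.out i).1
  let C : Type u := Σ t : lam.ord.ToType, Set (Iio t)
  have hC : #C ≤ lam := mk_sigma_toType_le hℵ.le fun t => by
    rw [mk_set]
    exact (hsl.isStrongPrelimit (mk_Iio_toType_lt t)).le
  obtain ⟨emb⟩ : Nonempty (C ↪ lam.ord.ToType) :=
    (Cardinal.le_def _ _).1 (hC.trans (mk_ord_toType lam).ge)
  let F : Set kap.ord.ToType → W → I → C := fun φ x i =>
    ⟨w x i, {y | ∃ α ∈ f i, α ∈ φ ∧ e i α = y.1}⟩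
  -- The codes of `φ` determine `φ`.
  have hF : ∀ φ ψ : Set kap.ord.ToType,
      (∀ x, ∀ᶠ i in (D : Filter I), F φ x i = F ψ x i) → φ ⊆ ψ := by
    intro φ ψ h α hα
    have hw : ∀ᶠ i in (D : Filter I), j (Quotient.mk _ α : W).out i = j α i :=
      Quotient.mk_out (s := eventuallyEqSetoid D j) α
    obtain ⟨i, h1, h2, h3⟩ := ((h (Quotient.mk _ α)).and (hw.and (hf α))).exists
    have hlt' : e i α < w (Quotient.mk _ α) i := by
      simp only [w, h2]
      exact hup _
    have h4 := eq_of_heq (Sigma.mk.inj_iff.1 h1).2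
    have h5 : (⟨e i α, hlt'⟩ : Iio (w (Quotient.mk _ α) i)) ∈
        {y : Iio (w (Quotient.mk _ α) i) | ∃ α ∈ f i, α ∈ ψ ∧ e i α = y.1} := by
      rw [← h4]
      exact ⟨α, h3, hα, rfl⟩
    obtain ⟨β, hβ, hβψ, hαβ⟩ := h5
    rwa [← he i hβ h3 hαβ]
  -- Each small set contains all codes of only few `φ`.
  let Φ : SmallSubsets lam lam → Set (Set kap.ord.ToType) := fun h =>
    {φ | ∀ x, ∀ᶠ i in (D : Filter I), emb (F φ x i) ∈ h.1}
  have hΦ : ∀ h, #(Φ h) < lam := by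
    intro h
    let p : Φ h × W → I → Option h.1 := fun φx i =>
      if hm : emb (F φx.1.1 φx.2 i) ∈ h.1 then some ⟨_, hm⟩ else none
    have hQ : #(Quotient (eventuallyEqSetoid D p)) < lam := by
      refine mk_quotient_eventuallyEqSetoid_lt hsl hℵ hrho hval ?_ p
      rw [mk_option]
      exact add_lt_of_lt hℵ.le h.2 (one_lt_aleph0.trans hℵ)
    have hinj : Function.Injective fun (φ : Φ h) (x : W) =>
        (Quotient.mk _ (φ, x) : Quotient (eventuallyEqSetoid D p)) := by
      intro φ ψ hφψ
      have key : ∀ x, ∀ᶠ i in (D : Filter I), F φ.1 x i = F ψ.1 x i := by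
        intro x
        have h1 : ∀ᶠ i in (D : Filter I), p (φ, x) i = p (ψ, x) i :=
          Quotient.exact (congrFun hφψ x)
        filter_upwards [h1, φ.2 x, ψ.2 x] with i h2 h3 h4
        simp only [p, dif_pos h3, dif_pos h4] at h2
        simpa using h2
      exact Subtype.ext (Subset.antisymm (hF _ _ key)
        (hF _ _ fun x => (key x).mono fun i hi => hi.symm))
    have h1 := mk_le_of_injective hinj
    rw [← power_def] at h1
    exact h1.trans_lt (power_lt_of_isStrongLimit hsl hℵ hQ hW)
  obtain ⟨S, hS, hS'⟩ := exists_cof_eq (α := SmallSubsets lam lam)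
  have hcover : (univ : Set (Set kap.ord.ToType)) ⊆ ⋃ h : S, Φ h.1 := by
    intro φ _
    choose X hX hX' using fun x => hval _ (mk_ord_toType lam).le fun i => emb (F φ x i)
    have hU : #(⋃ x, X x) < lam := by
      refine (mk_iUnion_le_sum_mk.trans (sum_le_sum _ (fun _ => rho) hX)).trans_lt ?_
      rw [sum_const']
      exact mul_lt_of_lt hℵ.le hW hrho
    obtain ⟨h, hh, hle⟩ := hS ⟨⋃ x, X x, hU⟩
    refine mem_iUnion.2 ⟨⟨h, hh⟩, fun x => (hX' x).mono fun i hi => ?_⟩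
    exact hle (mem_iUnion.2 ⟨x, hi⟩)
  have hle : 2 ^ kap ≤ #S * lam := by
    have h1 := (mk_le_mk_of_subset hcover).trans
      (mk_iUnion_le_sum_mk.trans (sum_le_sum _ (fun _ => lam) fun h => (hΦ h.1).le))
    rwa [mk_univ, mk_set, mk_ord_toType, sum_const'] at h1
  refine absurd hle (not_le.2 (mul_lt_of_lt ?_ (hS'.trans_lt hcof) (hlt.trans (cantor kap))))
  exact (hlam.aleph0_le.trans hlt.le).trans (cantor kap).le

end RegularUltrafilters

theorem theorem6p5 {I : Type v} (D : Ultrafilter I) (lam kap : Cardinal.{u})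
    (hlam : lam.IsSingular) (hlt : lam < kap) (hcof : lam.ord.cof ≠ kap.ord.cof)
    (hreg : RegularUltrafilters.IsRegularUltrafilter D (Order.succ lam) kap) :
    (((lam.IsStrongLimit ∧ Order.cof (RegularUltrafilters.SmallSubsets lam lam) < 2 ^ kap) ∨
        lam ^< lam < kap ∨
        (kap.IsRegular ∧ ¬ ∃ a : Set Cardinal.{u}, (∀ c ∈ a, c < lam) ∧
          #a < Cardinal.lift.{u + 1} lam ∧ IsLUB a lam ∧ kap ∈ RegularUltrafilters.pcf a)) →
      RegularUltrafilters.IsDecomposable D lam ∨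
        ∃ lam' : Cardinal.{u}, ℵ₀ ≤ lam' ∧ lam' < lam ∧
          RegularUltrafilters.IsRegularUltrafilter D lam' kap) ∧
    (lam ^< lam < 2 ^ kap →
      Order.cof (RegularUltrafilters.SmallSubsets lam lam) < 2 ^ kap) := by
  refine ⟨fun h => or_iff_not_imp_left.2 fun hD => ?_, fun h =>
    ((Order.cof_le_cardinalMk _).trans
      (RegularUltrafilters.mk_smallSubsets_le_powerlt hlam.aleph0_le)).trans_lt h⟩
  rcases h with ⟨hsl, hS⟩ | hS | ⟨hkap, hpcf⟩
  · by_cases hH : ∃ H : I → lam.ord.ToType, ∀ t, ∀ᶠ i in (D : Filter I), t < H i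
    · obtain ⟨H, hH⟩ := hH
      exact absurd
        (RegularUltrafilters.isDecomposable_of_isStrongLimit hlam hsl hlt hreg hH hS) hD
    · exact RegularUltrafilters.exists_isRegularUltrafilter_of_forall_bounded hlam hlt hcof hreg hH
  · exact RegularUltrafilters.exists_isRegularUltrafilter_of_mk_smallSubsets_lt hlam hlt hcof hreg hD
      ((RegularUltrafilters.mk_smallSubsets_le_powerlt hlam.aleph0_le).trans_lt hS)
  · by_contra! hnreg
    exact hpcf (RegularUltrafilters.exists_mem_pcf hlam hkap hlt hreg hD hnreg)
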